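/- Identify the Riemannian product $\mathbb S^2\times\mathbb R$ with $\mathbb R^3\setminus\{0\}$, endowed with the metric $\frac{1}{|x|^2}(dx_1^2+dx_2^2+dx_3^2)$, by means of the isometry $(y,t)\mapsto e^t y$, and let $E_j(x)=|x|\,\partial_{x_j}$ ($j=1,2,3$) be its global orthonormal frame. Let $\Sigma$ be a connected Riemann surface (equivalently, a connected oriented Riemannian surface considered with its conformal coordinates), let $X:\Sigma\to\mathbb S^2\times\mathbb R$ be a smooth minimal conformal immersion, and let $N=N_1E_1+N_2E_2+N_3E_3$ be a (continuous) unit normal field along $X$. The Gauss map of $X$ is $$g=\frac{N_1+iN_2}{1+N_3}:\Sigma\to\overline{\mathbb C}=\mathbb C\cup\{\infty\},$$ that is, the stereographic projection of $(N_1,N_2,N_3)$ from the south pole. Suppose that $g$ is singular, i.e. $\det dg=0$ at every point of $\Sigma$. Then there is a geodesic $\gamma$ of $\mathbb S^2$ such that $X(\Sigma)$ is contained in the vertical cylinder $\gamma\times\mathbb R$ (that is, $X(\Sigma)$ is part of a vertical cylinder over a geodesic of $\mathbb S^2$), and $g$ is constant. -/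

import Mathlib

open scoped Manifold ContDiff

noncomputable section

namespace S2R

/-- Euclidean three-space. -/
abbrev E3 : Type := EuclideanSpace ℝ (Fin 3)

/-- The unit two-sphere of Euclidean three-space. -/
abbrev S2 : Type := Metric.sphere (0 : E3) 1

/-! ### The Riemannian manifold `S² × ℝ`, in the model `ℝ³ ∖ {0}` -/

/-- The isometry `(y, t) ↦ e ^ t y` from the Riemannian product `S² × ℝ` onto `ℝ³ ∖ {0}` with the
metric `metric` below. -/
def toModel (q : S2 × ℝ) : E3 := Real.exp q.2 • (q.1 : E3)

/-- The metric `(dx₁² + dx₂² + dx₃²) / |x|²` at the point `x`, on the tangent vectors `V`, `W`. -/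
def metric (x V W : E3) : ℝ := inner ℝ V W / ‖x‖ ^ 2

/-- The global orthonormal frame `E_j(x) = |x| ∂_j` of `metric`. -/
def frame (x : E3) (j : Fin 3) : E3 := ‖x‖ • EuclideanSpace.single j (1 : ℝ)

/-- The Christoffel symbols of the first kind, contracted with the constant fields `V`, `W`, `Z`:
`(∂_V g(W, Z) + ∂_W g(V, Z) - ∂_Z g(V, W)) / 2`, where `g = metric`. -/
def christoffelFirst (x V W Z : E3) : ℝ :=
  (fderiv ℝ (fun y => metric y W Z) x V + fderiv ℝ (fun y => metric y V Z) x W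
    - fderiv ℝ (fun y => metric y V W) x Z) / 2

/-- The Christoffel symbols `Γ_x(V, W)` of `metric`: the vector whose product with every `Z` is
`christoffelFirst x V W Z`, written in the orthonormal frame. -/
def christoffel (x V W : E3) : E3 :=
  ∑ k, christoffelFirst x V W (frame x k) • frame x k

/-! ### Local theory of surfaces, for a parametrization `Y` with parameter `z = u + i v` -/

/-- The coordinate directions `∂_u`, `∂_v`. -/
def dir : Fin 2 → ℂ := ![1, Complex.I]

/-- The coordinate tangent vectors `Y_u`, `Y_v` of `Y` at `z`. -/
def tangent (Y : ℂ → E3) (z : ℂ) (a : Fin 2) : E3 := fderiv ℝ Y z (dir a)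

/-- The covariant derivative `∇_{Y_a} Y_b` along `Y` for the Levi-Civita connection of `metric`. -/
def covDeriv (Y : ℂ → E3) (z : ℂ) (a b : Fin 2) : E3 :=
  fderiv ℝ (fun w => tangent Y w b) z (dir a)
    + christoffel (Y z) (tangent Y z a) (tangent Y z b)

/-- The matrix of the first fundamental form. -/
def firstForm (Y : ℂ → E3) (z : ℂ) : Matrix (Fin 2) (Fin 2) ℝ :=
  Matrix.of fun a b => metric (Y z) (tangent Y z a) (tangent Y z b)

/-- The matrix of the second fundamental form in the direction of a normal vector `ν`. -/
def secondForm (Y : ℂ → E3) (z : ℂ) (ν : E3) : Matrix (Fin 2) (Fin 2) ℝ :=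
  Matrix.of fun a b => metric (Y z) (covDeriv Y z a b) ν

/-- `ν` is a normal vector of `Y` at `z`. -/
def IsNormalVector (Y : ℂ → E3) (z : ℂ) (ν : E3) : Prop :=
  ∀ a, metric (Y z) ν (tangent Y z a) = 0

/-- The mean curvature of `Y` at `z` in the direction of a normal vector `ν`. -/
def meanCurvature (Y : ℂ → E3) (z : ℂ) (ν : E3) : ℝ :=
  ((firstForm Y z)⁻¹ * secondForm Y z ν).trace / 2

/-! ### Immersions of a Riemann surface -/

section Surface

variable {M : Type*} [TopologicalSpace M] [ChartedSpace ℂ M]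

/-- `X` is a minimal conformal immersion of the Riemann surface `M` (whose conformal coordinates
are its complex charts) into `S² × ℝ`, in the model `ℝ³ ∖ {0}`. -/
structure IsMinimalConformalImmersion (X : M → E3) : Prop where
  ne_zero : ∀ p, X p ≠ 0
  smooth : ContMDiff 𝓘(ℝ, ℂ) 𝓘(ℝ, E3) ∞ X
  immersion : ∀ e ∈ atlas ℂ M, ∀ z ∈ e.target, Function.Injective (fderiv ℝ (X ∘ e.symm) z)
  conformal : ∀ e ∈ atlas ℂ M, ∀ z ∈ e.target,
    firstForm (X ∘ e.symm) z 0 0 = firstForm (X ∘ e.symm) z 1 1 ∧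
      firstForm (X ∘ e.symm) z 0 1 = 0
  minimal : ∀ e ∈ atlas ℂ M, ∀ z ∈ e.target, ∀ ν, IsNormalVector (X ∘ e.symm) z ν →
    meanCurvature (X ∘ e.symm) z ν = 0

/-- `N` is a unit normal field along `X`. -/
structure IsUnitNormalField (X N : M → E3) : Prop where
  continuous : Continuous N
  unit : ∀ p, metric (X p) (N p) (N p) = 1
  normal : ∀ e ∈ atlas ℂ M, ∀ z ∈ e.target, IsNormalVector (X ∘ e.symm) z (N (e.symm z))

/-- The components `(N₁, N₂, N₃)` in the frame `E₁, E₂, E₃` of a tangent vector `V` at `x`. -/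
def frameComponents (x V : E3) : E3 := !₂[metric x V (frame x 0), metric x V (frame x 1),
  metric x V (frame x 2)]

/-- Stereographic projection of the unit sphere from the south pole onto `ℂ ∪ {∞}`. -/
def stereo (n : E3) : OnePoint ℂ :=
  if 1 + n 2 = 0 then OnePoint.infty
  else (((n 0 + n 1 * Complex.I) / (1 + n 2) : ℂ) : OnePoint ℂ)

/-- The Gauss map of `X`, for the unit normal field `N`. -/
def gaussMap (X N : M → E3) (p : M) : OnePoint ℂ := stereo (frameComponents (X p) (N p))

/-- The coordinate `w` of `ℂ ∪ {∞}`, used away from `∞`. -/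
def coordZero (w : OnePoint ℂ) : ℂ := w.elim 0 id

/-- The coordinate `1 / w` of `ℂ ∪ {∞}`, used away from `0`. -/
def coordInfty (w : OnePoint ℂ) : ℂ := w.elim 0 fun w => w⁻¹

/-- The map `g` into the Riemann sphere is singular: `det dg` vanishes at every point, in the
coordinates of the Riemann sphere that are defined at its value there. -/
def IsSingularMap (g : M → OnePoint ℂ) : Prop :=
  ∀ e ∈ atlas ℂ M, ∀ z ∈ e.target,
    (g (e.symm z) ≠ OnePoint.infty → (fderiv ℝ (coordZero ∘ g ∘ e.symm) z).det = 0) ∧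
    (g (e.symm z) ≠ ((0 : ℂ) : OnePoint ℂ) →
      (fderiv ℝ (coordInfty ∘ g ∘ e.symm) z).det = 0)

end Surface

/-! ### Vertical cylinders -/

/-- `γ` is a complete unit-speed geodesic of `S²`: its acceleration has no tangential part. -/
structure IsSphereGeodesic (γ : ℝ → S2) : Prop where
  smooth : ContDiff ℝ ∞ (fun s => (γ s : E3))
  unit_speed : ∀ s, ‖deriv (fun s => (γ s : E3)) s‖ = 1
  geodesic : ∀ s, ∀ w : E3, inner ℝ w (γ s : E3) = 0 →
    inner ℝ (deriv (deriv fun s => (γ s : E3)) s) w = 0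

/-- The vertical cylinder over the curve `γ` in `S² × ℝ`. -/
def verticalCylinder (γ : ℝ → S2) : Set (S2 × ℝ) := Set.range γ ×ˢ Set.univ

end S2R

end

/-!
The theorem is a statement about surfaces in Euclidean three-space. The metric of `S² × ℝ` in the
model is conformal to the Euclidean one, so the frame components `n = N / |X|` of the unit normal
are the Euclidean unit normal, and with `h = ⟪Y, n⟫` minimality of a conformal parametrization `Y`
becomes `⟪ΔY, n⟫ |Y|² + 2 |Y_u|² h = 0` (`inner_laplacian_of_meanCurvature_eq_zero`). A singular
Gauss map means that `dn` has rank at most one (`exists_fderiv_eq_zero_of_stereo`), i.e. that the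
surface is developable in `ℝ³`.

The heart of the argument is that `dn = 0` (`fderiv_normal_eq_zero`). Otherwise some coordinate `σ`
of `n` has nonzero differential near a point, and `n` is there a function of `σ`. So are `h`, the
derivatives `n'`, `n''` of `n` and the derivatives `h'`, `h''` of `h` with respect to `σ`, since
`df = f' dσ` forces `df' ∧ dσ = 0` (`exists_derivative_of_dependsOn`). From `⟪Y, n'⟫ = h'` one gets
`⟪dY, n'⟫ = c dσ` with `c = h'' - ⟪Y, n''⟫`, and the minimal surface equation turns into
`|n'|² |Y|² = 2 h c`. The curves `σ = const` are the rulings, on which `Y` moves along a straight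
line while `n`, `n'`, `n''`, `h`, `h''` stay constant. The left side of the equation is therefore
quadratic along the ruling with leading coefficient `|n'|² ≠ 0`, and the right side is affine: a
contradiction (`false_of_rank_one`). It is reached by differentiating twice along the kernel of
`dσ`, without straightening the rulings.

So `n` is locally constant, hence a constant `c` on the connected surface; the minimal surface
equation gives `⟪X, c⟫ = 0`. A plane through the origin is the cylinder over a great circle.
-/

namespace S2R

/-! ### Functions whose differentials are proportional to a given one -/

section Proportional

variable {F : Type*} [NormedAddCommGroup F] [NormedSpace ℝ F]

/-- The differential of `f` at `z` is proportional to that of `σ`: `dσ ∧ df = 0`. Where `dσ ≠ 0`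
on an open set this says that `f` is locally a function of `σ`. -/
def DependsOn (σ : ℂ → ℝ) (f : ℂ → F) (z : ℂ) : Prop :=
  ∀ a b, fderiv ℝ σ z a • fderiv ℝ f z b = fderiv ℝ σ z b • fderiv ℝ f z a

lemma DependsOn.fderiv_eq_zero {σ : ℂ → ℝ} {f : ℂ → F} {z w : ℂ} (h : DependsOn σ f z)
    (hσ : fderiv ℝ σ z ≠ 0) (hw : fderiv ℝ σ z w = 0) : fderiv ℝ f z w = 0 := by
  obtain ⟨a, ha⟩ := DFunLike.exists_ne hσ
  have := h a w
  rw [hw, zero_smul] at this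
  exact (smul_eq_zero.1 this).resolve_left ha

lemma contDiffOn_fderiv_apply {U : Set ℂ} (hU : IsOpen U) {f : ℂ → F}
    (hf : ContDiffOn ℝ ∞ f U) (a : ℂ) : ContDiffOn ℝ ∞ (fun z => fderiv ℝ f z a) U :=
  (hf.fderiv_of_isOpen hU (by simp)).clm_apply contDiffOn_const

lemma _root_.ContDiffOn.differentiableAt_of_isOpen {U : Set ℂ} (hU : IsOpen U) {f : ℂ → F}
    (hf : ContDiffOn ℝ ∞ f U) {z : ℂ} (hz : z ∈ U) : DifferentiableAt ℝ f z :=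
  (hf.contDiffAt (hU.mem_nhds hz)).differentiableAt (by simp)

lemma fderiv_fderiv_apply_comm {U : Set ℂ} (hU : IsOpen U) {f : ℂ → F}
    (hf : ContDiffOn ℝ ∞ f U) {z : ℂ} (hz : z ∈ U) (a b : ℂ) :
    fderiv ℝ (fun w => fderiv ℝ f w a) z b = fderiv ℝ (fun w => fderiv ℝ f w b) z a := by
  have hd : DifferentiableAt ℝ (fderiv ℝ f) z :=
    (hf.fderiv_of_isOpen hU (m := ∞) (by simp)).differentiableAt_of_isOpen hU hz
  have hs : IsSymmSndFDerivAt ℝ f z :=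
    (hf.contDiffAt (hU.mem_nhds hz)).isSymmSndFDerivAt (by
      simpa [minSmoothness] using WithTop.coe_le_coe.2 (le_top (a := (2 : ℕ∞))))
  rw [fderiv_clm_apply hd (differentiableAt_const a), fderiv_clm_apply hd (differentiableAt_const b)]
  simpa using hs b a

/-- If `dσ ≠ 0` and `df` is proportional to `dσ`, then `df = f' dσ`, and `df'` is again
proportional to `dσ`, because `0 = d(df) = df' ∧ dσ`. -/
lemma exists_derivative_of_dependsOn {U : Set ℂ} (hU : IsOpen U) {σ : ℂ → ℝ} {f : ℂ → F}
    (hσ : ContDiffOn ℝ ∞ σ U) (hf : ContDiffOn ℝ ∞ f U) (h0 : ∀ z ∈ U, fderiv ℝ σ z ≠ 0)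
    (h : ∀ z ∈ U, DependsOn σ f z) :
    ∃ f' : ℂ → F, ContDiffOn ℝ ∞ f' U ∧
      (∀ z ∈ U, ∀ a, fderiv ℝ f z a = fderiv ℝ σ z a • f' z) ∧ ∀ z ∈ U, DependsOn σ f' z := by
  have hG : ∀ z ∈ U, fderiv ℝ σ z 1 ^ 2 + fderiv ℝ σ z Complex.I ^ 2 ≠ 0 := by
    intro z hz hG
    have h1 : fderiv ℝ σ z 1 = 0 := by nlinarith [sq_nonneg (fderiv ℝ σ z Complex.I)]
    have h2 : fderiv ℝ σ z Complex.I = 0 := by nlinarith [sq_nonneg (fderiv ℝ σ z 1)]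
    refine h0 z hz (ContinuousLinearMap.coe_injective (Complex.basisOneI.ext fun i : Fin 2 => ?_))
    fin_cases i <;> simp [h1, h2]
  have c := fun a => contDiffOn_fderiv_apply hU hσ a
  have d := fun a => contDiffOn_fderiv_apply hU hf a
  set f' : ℂ → F := fun z => (fderiv ℝ σ z 1 ^ 2 + fderiv ℝ σ z Complex.I ^ 2)⁻¹ •
    (fderiv ℝ σ z 1 • fderiv ℝ f z 1 + fderiv ℝ σ z Complex.I • fderiv ℝ f z Complex.I) with hf'
  have hc : ContDiffOn ℝ ∞ f' U :=
    ((((c 1).pow 2).add ((c Complex.I).pow 2)).inv hG).smul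
      (((c 1).smul (d 1)).add ((c Complex.I).smul (d Complex.I)))
  have he : ∀ z ∈ U, ∀ a, fderiv ℝ f z a = fderiv ℝ σ z a • f' z := by
    intro z hz a
    have e1 := h z hz a 1
    have e2 := h z hz a Complex.I
    simp only [hf']
    rw [smul_comm, smul_add, smul_comm _ (fderiv ℝ σ z 1), smul_comm _ (fderiv ℝ σ z Complex.I), e1,
      e2, smul_smul, smul_smul, ← add_smul, ← sq, ← sq, smul_smul, inv_mul_cancel₀ (hG z hz),
      one_smul]
  refine ⟨f', hc, he, fun z hz a b => ?_⟩
  have key : ∀ a b, fderiv ℝ (fun w => fderiv ℝ f w a) z b =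
      fderiv ℝ σ z a • fderiv ℝ f' z b + fderiv ℝ (fun w => fderiv ℝ σ w a) z b • f' z := by
    intro a b
    have : (fun w => fderiv ℝ f w a) =ᶠ[nhds z] fun w => fderiv ℝ σ w a • f' w := by
      filter_upwards [hU.mem_nhds hz] with w hw using he w hw a
    rw [this.fderiv_eq, fderiv_fun_smul ((c a).differentiableAt_of_isOpen hU hz)
      (hc.differentiableAt_of_isOpen hU hz)]
    simp
  have := key a b
  rw [fderiv_fderiv_apply_comm hU hf hz, key b a, fderiv_fderiv_apply_comm hU hσ hz] at this
  exact (add_right_cancel this).symm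

end Proportional

/-! ### Orthogonal triples in Euclidean three-space -/

/-- Parseval's identity for an orthogonal, not necessarily normalized, triple. -/
lemma inner_eq_of_orthogonal {a b c : E3} (ha : a ≠ 0) (hb : b ≠ 0) (hc : c ≠ 0)
    (hab : inner ℝ a b = 0) (hac : inner ℝ a c = 0) (hbc : inner ℝ b c = 0) (x y : E3) :
    inner ℝ x y = inner ℝ x a * inner ℝ a y / inner ℝ a a + inner ℝ x b * inner ℝ b y / inner ℝ b b
      + inner ℝ x c * inner ℝ c y / inner ℝ c c := by
  have hv : Orthonormal ℝ ![‖a‖⁻¹ • a, ‖b‖⁻¹ • b, ‖c‖⁻¹ • c] := by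
    constructor
    · intro i
      fin_cases i <;> simp [norm_smul, ha, hb, hc]
    · intro i j hij
      fin_cases i <;> fin_cases j <;>
        simp_all [inner_smul_left, inner_smul_right, real_inner_comm]
  let B := OrthonormalBasis.mk hv (by
    rw [hv.linearIndependent.span_eq_top_of_card_eq_finrank' (by simp)])
  have := B.sum_inner_mul_inner x y
  rw [← this]
  simp only [B, OrthonormalBasis.coe_mk, Fin.sum_univ_three, Matrix.cons_val_zero,
    Matrix.cons_val_one, Matrix.cons_val, inner_smul_left, inner_smul_right,
    real_inner_self_eq_norm_sq]
  simp only [conj_trivial]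
  field_simp

/-! ### A surface with singular Gauss map -/

section Core

variable {U : Set ℂ} {Y n : ℂ → E3}

lemma inner_fderiv_eq_zero_of_unit {z : ℂ} (hn : DifferentiableAt ℝ n z)
    (hunit : ∀ᶠ y in nhds z, inner ℝ (n y) (n y) = 1) (a : ℂ) :
    inner ℝ (n z) (fderiv ℝ n z a) = 0 := by
  have e : (fun y => inner ℝ (n y) (n y)) =ᶠ[nhds z] fun _ => (1 : ℝ) := hunit
  have e1 := DFunLike.congr_fun (e.fderiv_eq (𝕜 := ℝ)) a
  rw [fderiv_inner_apply ℝ hn hn, real_inner_comm (n z) (fderiv ℝ n z a), fderiv_fun_const] at e1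
  have e2 : inner ℝ (n z) (fderiv ℝ n z a) + inner ℝ (n z) (fderiv ℝ n z a) = 0 := e1
  linarith

/-- The rank-one case of the local rigidity statement `fderiv_normal_eq_zero`, near a point where
a coordinate `σ` of the normal has nonzero differential. -/
lemma false_of_rank_one (hU : IsOpen U) {z₀ : ℂ} (hz₀ : z₀ ∈ U)
    (hY : ContDiffOn ℝ ∞ Y U) (hn : ContDiffOn ℝ ∞ n U)
    (hunit : ∀ z ∈ U, inner ℝ (n z) (n z) = 1)
    (hnor : ∀ z ∈ U, ∀ a, inner ℝ (fderiv ℝ Y z a) (n z) = 0)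
    (hinj : ∀ z ∈ U, Function.Injective (fderiv ℝ Y z))
    (hconf : ∀ z ∈ U, inner ℝ (fderiv ℝ Y z 1) (fderiv ℝ Y z 1) =
      inner ℝ (fderiv ℝ Y z Complex.I) (fderiv ℝ Y z Complex.I))
    (horth : ∀ z ∈ U, inner ℝ (fderiv ℝ Y z 1) (fderiv ℝ Y z Complex.I) = 0)
    (hmin : ∀ z ∈ U, (inner ℝ (fderiv ℝ Y z 1) (fderiv ℝ n z 1) +
        inner ℝ (fderiv ℝ Y z Complex.I) (fderiv ℝ n z Complex.I)) * inner ℝ (Y z) (Y z) =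
      2 * inner ℝ (fderiv ℝ Y z 1) (fderiv ℝ Y z 1) * inner ℝ (Y z) (n z))
    {σ : ℂ → ℝ} (hσ : ContDiffOn ℝ ∞ σ U) (h0 : ∀ z ∈ U, fderiv ℝ σ z ≠ 0)
    (hdep : ∀ z ∈ U, DependsOn σ n z) (hn0 : ∀ z ∈ U, fderiv ℝ n z ≠ 0) : False := by
  obtain ⟨n', hn', en, dn'⟩ := exists_derivative_of_dependsOn hU hσ hn h0 hdep
  obtain ⟨n'', hn'', en', dn''⟩ := exists_derivative_of_dependsOn hU hσ hn' h0 dn'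
  have hh : ContDiffOn ℝ ∞ (fun z => inner ℝ (Y z) (n z)) U := hY.inner ℝ hn
  have dY {z} (hz : z ∈ U) := hY.differentiableAt_of_isOpen hU hz
  have dN {z} (hz : z ∈ U) := hn.differentiableAt_of_isOpen hU hz
  have dN' {z} (hz : z ∈ U) := hn'.differentiableAt_of_isOpen hU hz
  have dN'' {z} (hz : z ∈ U) := hn''.differentiableAt_of_isOpen hU hz
  have fh : ∀ z ∈ U, ∀ a, fderiv ℝ (fun z => inner ℝ (Y z) (n z)) z a =
      fderiv ℝ σ z a * inner ℝ (Y z) (n' z) := by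
    intro z hz a
    rw [fderiv_inner_apply ℝ (dY hz) (dN hz), hnor z hz, en z hz, inner_smul_right, add_zero]
  obtain ⟨h', hh', eh, dh'⟩ := exists_derivative_of_dependsOn hU hσ hh h0 (fun z hz a b => by
    rw [fh z hz, fh z hz]; simp only [smul_eq_mul]; ring)
  obtain ⟨h'', hh'', eh', dh''⟩ := exists_derivative_of_dependsOn hU hσ hh' h0 dh'
  -- `dY` is tangent, so `dh = ⟪Y, dn⟫ = ⟪Y, n'⟫ dσ`
  have hh'eq : ∀ z ∈ U, inner ℝ (Y z) (n' z) = h' z := by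
    intro z hz
    obtain ⟨a, ha⟩ := DFunLike.exists_ne (h0 z hz)
    have := fh z hz a
    rw [eh z hz, smul_eq_mul] at this
    exact (mul_left_cancel₀ ha this).symm
  have hc : ∀ z ∈ U, ∀ a, inner ℝ (fderiv ℝ Y z a) (n' z) =
      (h'' z - inner ℝ (Y z) (n'' z)) * fderiv ℝ σ z a := by
    intro z hz a
    have e : (fun z => inner ℝ (Y z) (n' z)) =ᶠ[nhds z] h' := by
      filter_upwards [hU.mem_nhds hz] with w hw using hh'eq w hw
    have e1 := DFunLike.congr_fun (e.fderiv_eq (𝕜 := ℝ)) a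
    simp only [eh' z hz a] at e1
    rw [fderiv_inner_apply ℝ (dY hz) (dN' hz), en' z hz, inner_smul_right, smul_eq_mul] at e1
    linarith
  have hn'0 : ∀ z ∈ U, n' z ≠ 0 := by
    intro z hz h
    exact hn0 z hz (ContinuousLinearMap.ext fun a => by simp [en z hz, h])
  have hnn' : ∀ z ∈ U, inner ℝ (n z) (n' z) = 0 := by
    intro z hz
    obtain ⟨a, ha⟩ := DFunLike.exists_ne (h0 z hz)
    have e := inner_fderiv_eq_zero_of_unit (dN hz)
      (Filter.eventually_of_mem (hU.mem_nhds hz) hunit) a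
    rw [en z hz, inner_smul_right] at e
    exact (mul_eq_zero.1 e).resolve_left ha
  have hnz : ∀ z ∈ U, n z ≠ 0 := fun z hz h => by simpa [h] using hunit z hz
  have hYa : ∀ z ∈ U, ∀ a, a ≠ 0 → fderiv ℝ Y z a ≠ 0 := fun z hz a ha h =>
    ha (hinj z hz (by simp [h]))
  -- the mean curvature equation: the curvature `k` satisfies `1 / k = - c / |n'|²`, `k |Y|² = -2h`
  have hquad : ∀ z ∈ U, inner ℝ (n' z) (n' z) * inner ℝ (Y z) (Y z) =
      2 * inner ℝ (Y z) (n z) * (h'' z - inner ℝ (Y z) (n'' z)) := by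
    intro z hz
    have p := inner_eq_of_orthogonal (hYa z hz 1 one_ne_zero) (hYa z hz _ Complex.I_ne_zero)
      (hnz z hz) (horth z hz) (hnor z hz _) (hnor z hz _) (n' z) (n' z)
    have m := hmin z hz
    have l0 : inner ℝ (fderiv ℝ Y z 1) (fderiv ℝ Y z 1) ≠ 0 :=
      inner_self_ne_zero.2 (hYa z hz 1 one_ne_zero)
    have n0 : inner ℝ (n' z) (n' z) ≠ 0 := inner_self_ne_zero.2 (hn'0 z hz)
    rw [real_inner_comm (fderiv ℝ Y z 1) (n' z), real_inner_comm (fderiv ℝ Y z Complex.I) (n' z),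
      hc z hz, hc z hz, hnn' z hz, ← hconf z hz, mul_zero, zero_div, add_zero] at p
    rw [en z hz, en z hz, inner_smul_right, inner_smul_right, hc z hz, hc z hz] at m
    generalize h'' z - inner ℝ (Y z) (n'' z) = c at *
    generalize inner ℝ (fderiv ℝ Y z 1) (fderiv ℝ Y z 1) = l at *
    field_simp at p
    refine mul_left_cancel₀ l0 ?_
    linear_combination (inner ℝ (Y z) (Y z)) * p + c * m
  -- `ξ` spans the kernel of `dσ`, so that `t = dY ξ` is the direction of the ruling
  set ξ : ℂ → ℂ := fun z => fderiv ℝ σ z Complex.I • (1 : ℂ) - fderiv ℝ σ z 1 • Complex.I with hξ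
  set t : ℂ → E3 := fun z => fderiv ℝ Y z (ξ z) with ht
  have σξ : ∀ z, fderiv ℝ σ z (ξ z) = 0 := by
    intro z
    simp only [hξ, map_sub, map_smul, smul_eq_mul]
    ring
  have ξ0 : ∀ z ∈ U, ξ z ≠ 0 := by
    intro z hz h
    refine h0 z hz (ContinuousLinearMap.coe_injective (Complex.basisOneI.ext fun i : Fin 2 => ?_))
    have h1 := congrArg Complex.re h
    have h2 := congrArg Complex.im h
    simp [hξ] at h1 h2
    fin_cases i <;> simp [h1, h2]
  have t0 : ∀ z ∈ U, t z ≠ 0 := fun z hz => hYa z hz _ (ξ0 z hz)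
  have tn : ∀ z ∈ U, inner ℝ (t z) (n z) = 0 := fun z hz => hnor z hz _
  have tn' : ∀ z ∈ U, inner ℝ (t z) (n' z) = 0 := fun z hz => by
    rw [ht]; simp only; rw [hc z hz, σξ, mul_zero]
  have nξ : ∀ z ∈ U, fderiv ℝ n z (ξ z) = 0 := fun z hz =>
    (hdep z hz).fderiv_eq_zero (h0 z hz) (σξ z)
  have n'ξ : ∀ z ∈ U, fderiv ℝ n' z (ξ z) = 0 := fun z hz =>
    (dn' z hz).fderiv_eq_zero (h0 z hz) (σξ z)
  have n''ξ : ∀ z ∈ U, fderiv ℝ n'' z (ξ z) = 0 := fun z hz =>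
    (dn'' z hz).fderiv_eq_zero (h0 z hz) (σξ z)
  have h''ξ : ∀ z ∈ U, fderiv ℝ h'' z (ξ z) = 0 := fun z hz =>
    (dh'' z hz).fderiv_eq_zero (h0 z hz) (σξ z)
  have hξ0 : ∀ z ∈ U, fderiv ℝ (fun z => inner ℝ (Y z) (n z)) z (ξ z) = 0 := fun z hz => by
    rw [fh z hz, σξ, zero_mul]
  have dh {z} (hz : z ∈ U) := hh.differentiableAt_of_isOpen hU hz
  have dh2 {z} (hz : z ∈ U) := hh''.differentiableAt_of_isOpen hU hz
  have dt {z} (hz : z ∈ U) : DifferentiableAt ℝ t z := by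
    have e : t = fun z => fderiv ℝ σ z Complex.I • fderiv ℝ Y z 1 -
        fderiv ℝ σ z 1 • fderiv ℝ Y z Complex.I := by
      funext z; simp only [ht, hξ, map_sub, map_smul]
    rw [e]
    have c := fun a => (contDiffOn_fderiv_apply hU hσ a).differentiableAt_of_isOpen hU hz
    have d := fun a => (contDiffOn_fderiv_apply hU hY a).differentiableAt_of_isOpen hU hz
    exact ((c _).fun_smul (d _)).fun_sub ((c _).fun_smul (d _))
  -- first derivative of `hquad` along the ruling
  set W : ℂ → E3 := fun z => inner ℝ (n' z) (n' z) • Y z + inner ℝ (Y z) (n z) • n'' z with hW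
  have tW : ∀ z ∈ U, inner ℝ (t z) (W z) = 0 := by
    intro z hz
    have e : (fun z => inner ℝ (n' z) (n' z) * inner ℝ (Y z) (Y z)) =ᶠ[nhds z] fun z =>
        2 * inner ℝ (Y z) (n z) * (h'' z - inner ℝ (Y z) (n'' z)) := by
      filter_upwards [hU.mem_nhds hz] with w hw using hquad w hw
    have e1 := DFunLike.congr_fun (e.fderiv_eq (𝕜 := ℝ)) (ξ z)
    rw [fderiv_fun_mul ((dN' hz).inner ℝ (dN' hz)) ((dY hz).inner ℝ (dY hz)),
      fderiv_fun_mul ((dh hz).const_mul 2) ((dh2 hz).fun_sub ((dY hz).inner ℝ (dN'' hz))),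
      fderiv_const_mul (dh hz), fderiv_fun_sub (dh2 hz) ((dY hz).inner ℝ (dN'' hz))] at e1
    simp only [add_apply, smul_apply, sub_apply, fderiv_inner_apply ℝ (dN' hz) (dN' hz),
      fderiv_inner_apply ℝ (dY hz) (dY hz), fderiv_inner_apply ℝ (dY hz) (dN'' hz),
      n'ξ z hz, n''ξ z hz, h''ξ z hz, hξ0 z hz, smul_eq_mul, inner_zero_left, inner_zero_right,
      add_zero, zero_add, mul_zero, real_inner_comm (fderiv ℝ Y z (ξ z)) (Y z)] at e1
    simp only [hW, ht, inner_add_right, inner_smul_right]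
    linarith
  -- second derivative along the ruling, at `z₀`
  have along : ∀ {V : ℂ → E3}, DifferentiableAt ℝ V z₀ → (∀ z ∈ U, inner ℝ (t z) (V z) = 0) →
      inner ℝ (t z₀) (fderiv ℝ V z₀ (ξ z₀)) + inner ℝ (fderiv ℝ t z₀ (ξ z₀)) (V z₀) = 0 := by
    intro V hV h
    have e : (fun z => inner ℝ (t z) (V z)) =ᶠ[nhds z₀] fun _ => (0 : ℝ) := by
      filter_upwards [hU.mem_nhds hz₀] with w hw using h w hw
    have e1 := DFunLike.congr_fun (e.fderiv_eq (𝕜 := ℝ)) (ξ z₀)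
    simp only [fderiv_fun_const] at e1
    rw [fderiv_inner_apply ℝ (dt hz₀) hV] at e1
    simpa using e1
  have dn2 := (dN' hz₀).inner ℝ (dN' hz₀)
  have dW : DifferentiableAt ℝ W z₀ := (dn2.fun_smul (dY hz₀)).add ((dh hz₀).fun_smul (dN'' hz₀))
  have a1 := along (dN hz₀) tn
  have a2 := along (dN' hz₀) tn'
  have a3 := along dW tW
  rw [nξ z₀ hz₀, inner_zero_right, zero_add] at a1
  rw [n'ξ z₀ hz₀, inner_zero_right, zero_add] at a2
  have Wξ : fderiv ℝ W z₀ (ξ z₀) = inner ℝ (n' z₀) (n' z₀) • t z₀ := by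
    rw [hW, fderiv_fun_add (dn2.fun_smul (dY hz₀)) ((dh hz₀).fun_smul (dN'' hz₀)),
      fderiv_fun_smul dn2 (dY hz₀), fderiv_fun_smul (dh hz₀) (dN'' hz₀)]
    simp only [add_apply, smul_apply, ContinuousLinearMap.smulRight_apply,
      fderiv_inner_apply ℝ (dN' hz₀) (dN' hz₀), n'ξ z₀ hz₀, n''ξ z₀ hz₀, hξ0 z₀ hz₀, ht,
      inner_zero_left, inner_zero_right, smul_zero, zero_smul, add_zero]
  -- the derivative of `t` along the ruling is parallel to `t`, hence orthogonal to `W`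
  have p := inner_eq_of_orthogonal (t0 z₀ hz₀) (hnz z₀ hz₀) (hn'0 z₀ hz₀) (tn z₀ hz₀)
    (tn' z₀ hz₀) (hnn' z₀ hz₀) (fderiv ℝ t z₀ (ξ z₀)) (W z₀)
  rw [a1, a2, tW z₀ hz₀] at p
  rw [p, Wξ, inner_smul_right] at a3
  simp [t0 z₀ hz₀, hn'0 z₀ hz₀] at a3

/-- Local rigidity: a conformal minimal surface of `S² × ℝ` whose Gauss map has rank at most one
has locally constant Gauss map. -/
theorem fderiv_normal_eq_zero (hU : IsOpen U)
    (hY : ContDiffOn ℝ ∞ Y U) (hn : ContDiffOn ℝ ∞ n U)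
    (hunit : ∀ z ∈ U, inner ℝ (n z) (n z) = 1)
    (hnor : ∀ z ∈ U, ∀ a, inner ℝ (fderiv ℝ Y z a) (n z) = 0)
    (hinj : ∀ z ∈ U, Function.Injective (fderiv ℝ Y z))
    (hconf : ∀ z ∈ U, inner ℝ (fderiv ℝ Y z 1) (fderiv ℝ Y z 1) =
      inner ℝ (fderiv ℝ Y z Complex.I) (fderiv ℝ Y z Complex.I))
    (horth : ∀ z ∈ U, inner ℝ (fderiv ℝ Y z 1) (fderiv ℝ Y z Complex.I) = 0)
    (hmin : ∀ z ∈ U, (inner ℝ (fderiv ℝ Y z 1) (fderiv ℝ n z 1) +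
        inner ℝ (fderiv ℝ Y z Complex.I) (fderiv ℝ n z Complex.I)) * inner ℝ (Y z) (Y z) =
      2 * inner ℝ (fderiv ℝ Y z 1) (fderiv ℝ Y z 1) * inner ℝ (Y z) (n z))
    (hsing : ∀ z ∈ U, ∃ w ≠ 0, fderiv ℝ n z w = 0) {z : ℂ} (hz : z ∈ U) :
    fderiv ℝ n z = 0 := by
  by_contra hne
  obtain ⟨a, ha⟩ := DFunLike.exists_ne hne
  obtain ⟨j, hj⟩ : ∃ j, fderiv ℝ n z a j ≠ 0 := by
    by_contra! h
    exact ha (PiLp.ext h)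
  set σ : ℂ → ℝ := fun w => n w j with hσdef
  have hσ : ContDiffOn ℝ ∞ σ U := by
    have := contDiffOn_piLp (p := 2) |>.1 hn
    exact this j
  have eσ : ∀ w ∈ U, ∀ a, fderiv ℝ σ w a = fderiv ℝ n w a j := by
    intro w hw a
    have := ((EuclideanSpace.proj j : E3 →L[ℝ] ℝ).hasFDerivAt.comp w
      (hn.differentiableAt_of_isOpen hU hw).hasFDerivAt).fderiv
    exact DFunLike.congr_fun this a
  have hcont : ContinuousOn (fun w => fderiv ℝ σ w) U :=
    (hσ.fderiv_of_isOpen hU (m := ∞) (by simp)).continuousOn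
  set V : Set ℂ := U ∩ (fun w => fderiv ℝ σ w) ⁻¹' {0}ᶜ with hV
  have hVo : IsOpen V := hcont.isOpen_inter_preimage hU isOpen_compl_singleton
  have hVU : V ⊆ U := Set.inter_subset_left
  have hzV : z ∈ V := ⟨hz, fun h => hj (by rw [← eσ z hz, show fderiv ℝ σ z = 0 from h]; rfl)⟩
  refine false_of_rank_one hVo hzV (hY.mono hVU) (hn.mono hVU) (fun w hw => hunit w (hVU hw))
    (fun w hw => hnor w (hVU hw)) (fun w hw => hinj w (hVU hw)) (fun w hw => hconf w (hVU hw))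
    (fun w hw => horth w (hVU hw)) (fun w hw => hmin w (hVU hw)) (hσ.mono hVU)
    (fun w hw => hw.2) (fun w hw => ?_) (fun w hw h => hw.2 ?_)
  · obtain ⟨x, hx, hx0⟩ := hsing w (hVU hw)
    have hxσ : fderiv ℝ σ w x = 0 := by rw [eσ w (hVU hw), hx0]; rfl
    have expand : ∀ {F : Type} [NormedAddCommGroup F] [NormedSpace ℝ F] (L : ℂ →L[ℝ] F) (y : ℂ),
        L y = y.re • L 1 + y.im • L Complex.I := by
      intro F _ _ L y
      rw [← map_smul, ← map_smul, ← map_add]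
      congr 1
      apply Complex.ext <;> simp
    rw [expand] at hx0 hxσ
    have hI : fderiv ℝ σ w 1 • fderiv ℝ n w Complex.I = fderiv ℝ σ w Complex.I • fderiv ℝ n w 1 := by
      have hx' : x.re ≠ 0 ∨ x.im ≠ 0 := by
        by_contra! h
        exact hx (Complex.ext h.1 h.2)
      simp only [smul_eq_mul] at hxσ
      generalize fderiv ℝ n w 1 = A at *
      generalize fderiv ℝ n w Complex.I = B at *
      rcases hx' with h | h <;> refine smul_right_injective _ h ?_ <;> simp only [smul_smul]
      · linear_combination (norm := module) hxσ • B - fderiv ℝ σ w Complex.I • hx0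
      · linear_combination (norm := module) fderiv ℝ σ w 1 • hx0 - hxσ • A
    intro a b
    rw [expand (fderiv ℝ σ w) a, expand (fderiv ℝ σ w) b, expand (fderiv ℝ n w) a,
      expand (fderiv ℝ n w) b]
    simp only [smul_eq_mul]
    linear_combination (norm := module) (a.re * b.im - a.im * b.re) • hI
  · exact ContinuousLinearMap.ext fun a => by rw [eσ w (hVU hw), h]; rfl

end Core

/-! ### The metric, its Christoffel symbols and the mean curvature equation -/

lemma inner_eq_sum (a b : E3) : inner ℝ a b = a 0 * b 0 + a 1 * b 1 + a 2 * b 2 := by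
  simp [PiLp.inner_apply, Fin.sum_univ_three, mul_comm]

lemma inner_frame (x V : E3) (k : Fin 3) : inner ℝ V (frame x k) = ‖x‖ * V k := by
  simp [frame, inner_smul_right, EuclideanSpace.inner_single_right]

lemma fderiv_metric {x : E3} (hx : x ≠ 0) (W Z V : E3) :
    fderiv ℝ (fun y => metric y W Z) x V = -2 * inner ℝ W Z * inner ℝ x V / ‖x‖ ^ 4 := by
  have h0 : ‖x‖ ^ 2 ≠ 0 := by simpa using hx
  have h1 := ((hasDerivAt_inv h0).comp_hasFDerivAt x
    (hasStrictFDerivAt_norm_sq x).hasFDerivAt).const_mul (inner ℝ W Z)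
  have h2 : (fun y => metric y W Z) = fun y => inner ℝ W Z * ((fun t : ℝ => t⁻¹) ∘
      fun y : E3 => ‖y‖ ^ 2) y := by
    funext y; simp [metric, div_eq_mul_inv]
  rw [h2, h1.fderiv]
  simp
  field_simp

lemma christoffelFirst_eq {x : E3} (hx : x ≠ 0) (V W Z : E3) :
    christoffelFirst x V W Z = -(inner ℝ W Z * inner ℝ x V + inner ℝ V Z * inner ℝ x W -
      inner ℝ V W * inner ℝ x Z) / ‖x‖ ^ 4 := by
  rw [christoffelFirst, fderiv_metric hx, fderiv_metric hx, fderiv_metric hx]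
  ring

/-- The Levi-Civita connection of the conformally flat metric `|dx|² / |x|²`. -/
lemma inner_christoffel {x : E3} (hx : x ≠ 0) (V W ν : E3) :
    inner ℝ (christoffel x V W) ν = -(inner ℝ W ν * inner ℝ x V + inner ℝ V ν * inner ℝ x W -
      inner ℝ V W * inner ℝ x ν) / ‖x‖ ^ 2 := by
  have h0 : ‖x‖ ≠ 0 := by simpa using hx
  have f : ∀ k, inner ℝ (frame x k) ν = ‖x‖ * ν k := fun k => by
    rw [real_inner_comm, inner_frame]
  rw [christoffel, Fin.sum_univ_three]
  simp only [inner_add_left, real_inner_smul_left, christoffelFirst_eq hx, inner_frame, f,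
    inner_eq_sum W ν, inner_eq_sum V ν, inner_eq_sum x ν]
  field_simp
  ring

lemma metric_eq_zero_iff {x : E3} (hx : x ≠ 0) (V W : E3) :
    metric x V W = 0 ↔ inner ℝ V W = 0 := by
  simp [metric, hx]

/-- The vanishing of the mean curvature in conformal coordinates: `⟪ΔY, ν⟫ |Y|² + 2 λ ⟪Y, ν⟫ = 0`,
where `λ = |Y_u|²`. -/
lemma inner_laplacian_of_meanCurvature_eq_zero {Y : ℂ → E3} {z : ℂ} {ν : E3} (h0 : Y z ≠ 0)
    (hconf : firstForm Y z 0 0 = firstForm Y z 1 1 ∧ firstForm Y z 0 1 = 0)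
    (ht : fderiv ℝ Y z 1 ≠ 0) (hν : IsNormalVector Y z ν) (hH : meanCurvature Y z ν = 0) :
    (inner ℝ (fderiv ℝ (fun w => fderiv ℝ Y w 1) z 1) ν +
      inner ℝ (fderiv ℝ (fun w => fderiv ℝ Y w Complex.I) z Complex.I) ν) * inner ℝ (Y z) (Y z) +
      2 * inner ℝ (fderiv ℝ Y z 1) (fderiv ℝ Y z 1) * inner ℝ (Y z) ν = 0 := by
  obtain ⟨c1, c2⟩ := hconf
  have c3 : firstForm Y z 1 0 = 0 := by
    rw [← c2]; simp [firstForm, metric, real_inner_comm]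
  set μ := firstForm Y z 0 0 with hμ
  have hn0 : ‖Y z‖ ≠ 0 := by simpa using h0
  have hμ0 : μ ≠ 0 := by
    rw [hμ]
    simp only [firstForm, Matrix.of_apply]
    rw [Ne, metric_eq_zero_iff h0]
    simpa [tangent, dir] using ht
  have hI : firstForm Y z = μ • (1 : Matrix (Fin 2) (Fin 2) ℝ) := by
    ext a b
    fin_cases a <;> fin_cases b <;> simp [c2, c3, ← c1, hμ]
  have hinv : (firstForm Y z)⁻¹ = μ⁻¹ • (1 : Matrix (Fin 2) (Fin 2) ℝ) := by
    refine Matrix.inv_eq_right_inv ?_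
    rw [hI, Matrix.smul_mul, Matrix.mul_smul, Matrix.one_mul, smul_smul, mul_inv_cancel₀ hμ0,
      one_smul]
  rw [meanCurvature, hinv, Matrix.smul_mul, Matrix.one_mul, Matrix.trace_smul,
    Matrix.trace_fin_two] at hH
  -- by conformality the first form is `μ • 1`, so only the trace of the second form matters
  have hS : secondForm Y z ν 0 0 + secondForm Y z ν 1 1 = 0 := by
    simpa [hμ0] using hH
  have n0 := (metric_eq_zero_iff h0 _ _).1 (hν 0)
  have n1 := (metric_eq_zero_iff h0 _ _).1 (hν 1)
  have l : inner ℝ (tangent Y z 0) (tangent Y z 0) = inner ℝ (tangent Y z 1) (tangent Y z 1) := by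
    have := c1
    rw [hμ] at this
    simp only [firstForm, Matrix.of_apply, metric] at this
    field_simp at this
    simpa using this
  simp only [secondForm, Matrix.of_apply, metric, covDeriv, inner_add_left,
    inner_christoffel h0, real_inner_comm ν (tangent _ _ _), n0, n1, ← l] at hS
  rw [real_inner_self_eq_norm_sq (Y z)]
  simp only [tangent, dir, Matrix.cons_val_zero, Matrix.cons_val_one] at hS
  field_simp at hS
  linear_combination hS

/-! ### Smoothness of the unit normal -/

/-- Near `q`, the unit normal is the normalized normal component of the constant vector `n q`. -/
lemma contDiffOn_normal {U : Set ℂ} {Y n : ℂ → E3} (hU : IsOpen U) (hY : ContDiffOn ℝ ∞ Y U)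
    (hn : ContinuousOn n U) (hunit : ∀ z ∈ U, inner ℝ (n z) (n z) = 1)
    (hnor : ∀ z ∈ U, ∀ a, inner ℝ (fderiv ℝ Y z a) (n z) = 0)
    (hinj : ∀ z ∈ U, Function.Injective (fderiv ℝ Y z))
    (horth : ∀ z ∈ U, inner ℝ (fderiv ℝ Y z 1) (fderiv ℝ Y z Complex.I) = 0) :
    ContDiffOn ℝ ∞ n U := by
  intro q hq
  refine ContDiffAt.contDiffWithinAt ?_
  have hYa : ∀ z ∈ U, ∀ a, a ≠ 0 → fderiv ℝ Y z a ≠ 0 := fun z hz a ha h =>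
    ha (hinj z hz (by simp [h]))
  have hnz : ∀ z ∈ U, n z ≠ 0 := fun z hz h => by simpa [h] using hunit z hz
  set m := n q with hm
  set P : ℂ → E3 := fun w => m -
    (inner ℝ m (fderiv ℝ Y w 1) / inner ℝ (fderiv ℝ Y w 1) (fderiv ℝ Y w 1)) • fderiv ℝ Y w 1 -
    (inner ℝ m (fderiv ℝ Y w Complex.I) / inner ℝ (fderiv ℝ Y w Complex.I) (fderiv ℝ Y w Complex.I))
      • fderiv ℝ Y w Complex.I with hP
  have hPn : ∀ w ∈ U, P w = inner ℝ m (n w) • n w := by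
    intro w hw
    refine ext_inner_right ℝ fun y => ?_
    have := inner_eq_of_orthogonal (hYa w hw 1 one_ne_zero) (hYa w hw _ Complex.I_ne_zero)
      (hnz w hw) (horth w hw) (hnor w hw _) (hnor w hw _) m y
    rw [hunit w hw, div_one] at this
    simp only [hP, inner_sub_left, real_inner_smul_left]
    rw [this]
    ring
  have hPc : ContDiffAt ℝ ∞ P q := by
    have c := fun a => (contDiffOn_fderiv_apply hU hY a).contDiffAt (hU.mem_nhds hq)
    have t : ∀ a, a ≠ 0 → ContDiffAt ℝ ∞ (fun w => (inner ℝ m (fderiv ℝ Y w a) /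
        inner ℝ (fderiv ℝ Y w a) (fderiv ℝ Y w a)) • fderiv ℝ Y w a) q := fun a ha =>
      ((contDiffAt_const.inner ℝ (c a)).div ((c a).inner ℝ (c a))
        (inner_self_ne_zero.2 (hYa q hq a ha))).smul (c a)
    exact (contDiffAt_const.sub (t 1 one_ne_zero)).sub (t _ Complex.I_ne_zero)
  have hPq : P q ≠ 0 := by
    rw [hPn q hq, ← hm, hm, hunit q hq, one_smul]
    exact hnz q hq
  have hpos : ∀ᶠ w in nhds q, 0 < inner ℝ m (n w) := by
    have : ContinuousAt (fun w => inner ℝ m (n w)) q :=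
      continuousAt_const.inner (hn.continuousAt (hU.mem_nhds hq))
    refine this.eventually (lt_mem_nhds ?_)
    simp only [hm]
    rw [hunit q hq]
    exact one_pos
  refine ((hPc.norm ℝ hPq).inv (norm_ne_zero_iff.2 hPq) |>.smul hPc).congr_of_eventuallyEq ?_
  filter_upwards [hpos, hU.mem_nhds hq] with w hw hwU
  have h1 : ‖n w‖ = 1 := by
    have := hunit w hwU
    rw [real_inner_self_eq_norm_sq] at this
    nlinarith [norm_nonneg (n w)]
  simp only [Pi.smul_apply', Pi.inv_apply]
  rw [hPn w hwU, norm_smul, h1, mul_one, Real.norm_of_nonneg hw.le, smul_smul,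
    inv_mul_cancel₀ hw.ne', one_smul]

/-! ### The Gauss map -/

/-- The frame `|x| ∂_j` turns the components of a vector into its Euclidean coordinates, up to
scale. In particular those of a unit normal form the Euclidean unit normal. -/
lemma frameComponents_eq {x : E3} (V : E3) : frameComponents x V = ‖x‖⁻¹ • V := by
  by_cases hx : x = 0
  · ext j
    fin_cases j <;> simp [frameComponents, metric, hx]
  have h0 : ‖x‖ ≠ 0 := by simpa using hx
  ext j
  fin_cases j <;> simp [frameComponents, metric, inner_frame] <;> field_simp

/-- The differential of the unit normal `n` is recovered from that of its stereographic projection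
from the south (`ε = 1`) or north (`ε = -1`) pole. -/
lemma fderiv_eq_zero_of_fderiv_stereo {n : ℂ → E3} {z w : ℂ} (hn : DifferentiableAt ℝ n z)
    (hunit : ∀ᶠ y in nhds z, inner ℝ (n y) (n y) = 1) {ε : ℝ} (hε : ε ^ 2 = 1)
    (hB : 1 + ε * n z 2 ≠ 0) {G : ℂ → ℂ}
    (hG : ∀ᶠ y in nhds z,
      G y = (1 + ε * n y 2)⁻¹ • (n y 0 • (1 : ℂ) + (ε * n y 1) • Complex.I))
    (hw : fderiv ℝ G z w = 0) : fderiv ℝ n z w = 0 := by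
  have H : ∀ j : Fin 3, HasFDerivAt (fun y => n y j)
      ((EuclideanSpace.proj j : E3 →L[ℝ] ℝ).comp (fderiv ℝ n z)) z := fun j =>
    (EuclideanSpace.proj j : E3 →L[ℝ] ℝ).hasFDerivAt.comp z hn.hasFDerivAt
  have hA := ((H 0).smul_const (1 : ℂ)).add (((H 1).const_mul ε).smul_const Complex.I)
  have hB' := ((H 2).const_mul ε).const_add 1
  have hGd : DifferentiableAt ℝ G z := by
    refine ((hB'.differentiableAt.inv hB).smul hA.differentiableAt).congr_of_eventuallyEq ?_
    filter_upwards [hG] with y hy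
    simpa using hy
  have hprod := hB'.fun_smul hGd.hasFDerivAt
  -- differentiate `(1 + ε n₂) G = n₀ + ε n₁ i` instead of the quotient
  have heq := hA.unique (hprod.congr_of_eventuallyEq (by
    filter_upwards [hG, hB'.continuousAt.eventually_ne hB] with y hy hy0
    simp only [Pi.add_apply]
    rw [hy, smul_smul, mul_inv_cancel₀ hy0, one_smul]))
  have hpt := DFunLike.congr_fun heq w
  have hu := inner_fderiv_eq_zero_of_unit hn hunit w
  have h1 := hunit.self_of_nhds
  rw [inner_eq_sum] at hu h1
  simp only [add_apply, smul_apply, ContinuousLinearMap.smulRight_apply,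
    ContinuousLinearMap.comp_apply, hw, smul_zero, zero_add, hG.self_of_nhds, smul_eq_mul,
    PiLp.proj_apply] at hpt
  have hre := congrArg Complex.re hpt
  have him := congrArg Complex.im hpt
  simp only [Complex.add_re, Complex.add_im, Complex.smul_re, Complex.smul_im, Complex.one_re,
    Complex.one_im, Complex.I_re, Complex.I_im, smul_eq_mul, mul_zero, mul_one, add_zero,
    zero_add] at hre him
  have hBc := mul_inv_cancel₀ hB
  generalize (1 + ε * n z 2)⁻¹ = c at *
  have e1 : fderiv ℝ n z w 1 = ε * fderiv ℝ n z w 2 * c * n z 1 := by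
    linear_combination ε * him + (ε * fderiv ℝ n z w 2 * c * n z 1 - fderiv ℝ n z w 1) * hε
  have e2 : fderiv ℝ n z w 2 = 0 := by
    have h2 : ε * fderiv ℝ n z w 2 = 0 := by
      rw [hre, e1] at hu
      linear_combination hu - ε * fderiv ℝ n z w 2 * c * h1 -
        ε * fderiv ℝ n z w 2 * (1 - ε * n z 2) * hBc +
        (n z 2 * fderiv ℝ n z w 2 - ε * fderiv ℝ n z w 2 * c * n z 2 ^ 2) * hε
    linear_combination ε * h2 - fderiv ℝ n z w 2 * hε
  ext j
  fin_cases j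
  · simpa [e2] using hre
  · simpa [e2] using e1
  · exact e2

/-- Where the Gauss map is singular, the differential of the unit normal has a kernel. -/
lemma exists_fderiv_eq_zero_of_stereo {n : ℂ → E3} {z : ℂ} (hn : DifferentiableAt ℝ n z)
    (hunit : ∀ᶠ y in nhds z, inner ℝ (n y) (n y) = 1)
    (h1 : stereo (n z) ≠ OnePoint.infty →
      (fderiv ℝ (fun y => coordZero (stereo (n y))) z).det = 0)
    (h2 : stereo (n z) ≠ ((0 : ℂ) : OnePoint ℂ) →
      (fderiv ℝ (fun y => coordInfty (stereo (n y))) z).det = 0) :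
    ∃ w ≠ 0, fderiv ℝ n z w = 0 := by
  have ker : ∀ L : ℂ →L[ℝ] ℂ, L.det = 0 → ∃ w ≠ 0, L w = 0 := fun L hL => by
    obtain ⟨w, hw, hw0⟩ := (Submodule.ne_bot_iff _).1
      (LinearMap.bot_lt_ker_of_det_eq_zero (f := (L : ℂ →ₗ[ℝ] ℂ)) hL).ne'
    exact ⟨w, hw0, hw⟩
  have hc : ContinuousAt (fun y => n y 2) z :=
    ((EuclideanSpace.proj 2 : E3 →L[ℝ] ℝ).continuous.continuousAt).comp hn.continuousAt
  by_cases hz : 1 + n z 2 = 0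
  · have hne : stereo (n z) ≠ ((0 : ℂ) : OnePoint ℂ) := by
      rw [stereo, if_pos hz]; exact OnePoint.infty_ne_coe _
    obtain ⟨w, hw, hw0⟩ := ker _ (h2 hne)
    have hB : 1 + (-1 : ℝ) * n z 2 ≠ 0 := by intro h; linarith
    refine ⟨w, hw, fderiv_eq_zero_of_fderiv_stereo hn hunit (ε := -1) (by norm_num) hB ?_ hw0⟩
    filter_upwards [hunit, (continuousAt_const.add (hc.const_mul (-1))).eventually_ne hB]
      with y hy hy0
    rw [inner_eq_sum] at hy
    simp only [Pi.add_apply] at hy0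
    -- at the south pole `1 / ∞` and `(n₀ - n₁ i) / (1 - n₂)` are both `0`
    by_cases hp : 1 + n y 2 = 0
    · have e2 : n y 2 = -1 := by linarith
      have e0 : n y 0 = 0 := by rw [e2] at hy; nlinarith [sq_nonneg (n y 0), sq_nonneg (n y 1)]
      have e1 : n y 1 = 0 := by rw [e2] at hy; nlinarith [sq_nonneg (n y 0), sq_nonneg (n y 1)]
      simp [stereo, hp, coordInfty, e0, e1]
    · have hp' : (1 + n y 2 : ℂ) ≠ 0 := by
        have := Complex.ofReal_ne_zero.2 hp
        push_cast at this
        exact this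
      have hm' : (1 + -1 * n y 2 : ℂ) ≠ 0 := by
        have := Complex.ofReal_ne_zero.2 hy0
        push_cast at this
        exact this
      have hyC : (n y 0 * n y 0 + n y 1 * n y 1 + n y 2 * n y 2 : ℂ) = 1 := by exact_mod_cast hy
      have hA : (n y 0 + n y 1 * Complex.I : ℂ) ≠ 0 := by
        intro h
        refine mul_ne_zero hp' hm' ?_
        linear_combination ((n y 0 : ℂ) - n y 1 * Complex.I) * h - hyC +
          (n y 1 : ℂ) ^ 2 * Complex.I_sq
      simp only [stereo, hp, if_false, coordInfty, OnePoint.elim_some, Complex.real_smul, inv_div]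
      push_cast
      rw [mul_one, inv_mul_eq_div, div_eq_div_iff hA hm']
      linear_combination -hyC + (n y 1 : ℂ) ^ 2 * Complex.I_sq
  · have hne : stereo (n z) ≠ OnePoint.infty := by
      rw [stereo, if_neg hz]; exact OnePoint.coe_ne_infty _
    obtain ⟨w, hw, hw0⟩ := ker _ (h1 hne)
    refine ⟨w, hw, fderiv_eq_zero_of_fderiv_stereo hn hunit (ε := 1) (by norm_num)
      (by rwa [one_mul]) ?_ hw0⟩
    filter_upwards [(continuousAt_const.add hc).eventually_ne hz] with y hy
    simp only [Pi.add_apply] at hy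
    simp only [stereo, hy, if_false, coordZero, OnePoint.elim_some, Complex.real_smul, id]
    push_cast
    rw [div_eq_inv_mul]
    ring

/-! ### Great circles -/

/-- A nonzero vector orthogonal to a unit vector `c` lies over the great circle in `c⊥`. -/
lemma exists_geodesic_of_inner_eq_zero {c : E3} (hc : inner ℝ c c = 1) :
    ∃ γ : ℝ → S2, IsSphereGeodesic γ ∧
      ∀ x : E3, x ≠ 0 → inner ℝ x c = 0 → x ∈ toModel '' verticalCylinder γ := by
  have hnc : ‖c‖ = 1 := by
    rw [real_inner_self_eq_norm_sq] at hc
    nlinarith [norm_nonneg c]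
  obtain ⟨b, hb⟩ := Orthonormal.exists_orthonormalBasis_extension_of_card_eq
    (𝕜 := ℝ) (E := E3) (ι := Fin 3) (by simp) (v := fun _ => c) (s := {2})
    ⟨fun _ => by simpa using hnc, fun i j hij => (hij (Subsingleton.elim _ _)).elim⟩
  have hb2 : b 2 = c := hb 2 rfl
  have o := b.orthonormal
  have h00 : ‖b 0‖ = 1 := o.1 0
  have h11 : ‖b 1‖ = 1 := o.1 1
  have h01 : inner ℝ (b 0) (b 1) = 0 := o.2 (by decide)
  set f : ℝ → E3 := fun s => Real.cos s • b 0 + Real.sin s • b 1 with hf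
  have hnorm : ∀ x y : ℝ, ‖x • b 0 + y • b 1‖ ^ 2 = x ^ 2 + y ^ 2 := by
    intro x y
    rw [norm_add_sq_real, norm_smul, norm_smul, h00, h11, inner_smul_left, inner_smul_right, h01]
    simp
  have hf1 : ∀ s, ‖f s‖ = 1 := by
    intro s
    have := hnorm (Real.cos s) (Real.sin s)
    rw [Real.cos_sq_add_sin_sq] at this
    exact (pow_eq_one_iff_of_nonneg (norm_nonneg _) two_ne_zero).1 this
  have d1 : deriv f = fun s => (-Real.sin s) • b 0 + Real.cos s • b 1 := by
    funext s
    exact (((Real.hasDerivAt_cos s).smul_const (b 0)).add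
      ((Real.hasDerivAt_sin s).smul_const (b 1))).deriv
  have d2 : deriv (deriv f) = fun s => -f s := by
    rw [d1]
    funext s
    refine (((Real.hasDerivAt_sin s).neg.smul_const (b 0)).add
      ((Real.hasDerivAt_cos s).smul_const (b 1))).deriv.trans ?_
    rw [hf]
    simp only [neg_smul, neg_add]
  refine ⟨fun s => ⟨f s, by simp [hf1]⟩, ⟨?_, ?_, ?_⟩, ?_⟩
  · exact (Real.contDiff_cos.smul contDiff_const).add (Real.contDiff_sin.smul contDiff_const)
  · intro s
    change ‖deriv f s‖ = 1
    rw [d1]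
    have := hnorm (-Real.sin s) (Real.cos s)
    rw [neg_sq, Real.sin_sq_add_cos_sq] at this
    exact (pow_eq_one_iff_of_nonneg (norm_nonneg _) two_ne_zero).1 this
  · intro s w hw
    change inner ℝ (deriv (deriv f) s) w = 0
    rw [d2]
    simp only [inner_neg_left, neg_eq_zero]
    rw [real_inner_comm]
    exact hw
  · intro x hx hxc
    set ζ : ℂ := ⟨inner ℝ (b 0) x, inner ℝ (b 1) x⟩ with hζ
    have hsum : x = ζ.re • b 0 + ζ.im • b 1 := by
      have := b.sum_repr' x
      rw [Fin.sum_univ_three, hb2, real_inner_comm x c, hxc, zero_smul, add_zero] at this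
      exact this.symm
    have hζ0 : ζ ≠ 0 := by
      intro h
      rw [h] at hsum
      exact hx (by simpa using hsum)
    refine ⟨(⟨f ζ.arg, by simp [hf1]⟩, Real.log ‖ζ‖), ⟨⟨ζ.arg, rfl⟩, trivial⟩, ?_⟩
    change Real.exp (Real.log ‖ζ‖) • f ζ.arg = x
    rw [Real.exp_log (norm_pos_iff.2 hζ0), hf]
    simp only [smul_add, smul_smul, Complex.norm_mul_cos_arg, Complex.norm_mul_sin_arg]
    exact hsum.symm

/-! ### Charts of a Riemann surface -/

section Surface

variable {M : Type*} [TopologicalSpace M] [ChartedSpace ℂ M] [IsManifold 𝓘(ℂ, ℂ) 1 M]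

/-- A Riemann surface is a smooth real surface: its transition maps are holomorphic. -/
lemma isManifold_real : IsManifold 𝓘(ℝ, ℂ) ∞ M := by
  refine isManifold_of_contDiffOn _ _ _ fun e e' he he' => ?_
  have h := contMDiffOn_of_mem_contDiffGroupoid
    (HasGroupoid.compatible (G := contDiffGroupoid 1 𝓘(ℂ, ℂ)) he he')
  rw [contMDiffOn_iff_contDiffOn] at h
  have h2 : ContDiffOn ℂ ∞ (e.symm ≫ₕ e') (e.symm ≫ₕ e').source :=
    (h.differentiableOn (by simp)).contDiffOn (e.symm ≫ₕ e').open_source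
  simpa using h2.restrict_scalars ℝ

lemma contDiffOn_comp_chart {X : M → E3} (hX : ContMDiff 𝓘(ℝ, ℂ) 𝓘(ℝ, E3) ∞ X)
    {e : OpenPartialHomeomorph M ℂ} (he : e ∈ atlas ℂ M) :
    ContDiffOn ℝ ∞ (X ∘ e.symm) e.target := by
  have := isManifold_real (M := M)
  rw [← contMDiffOn_iff_contDiffOn]
  exact hX.comp_contMDiffOn (contMDiffOn_symm_of_mem_maximalAtlas
    (IsManifold.subset_maximalAtlas he))

/-- In a chart, a minimal conformal immersion with singular Gauss map has locally constant Euclidean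
unit normal, and that normal is orthogonal to the position vector. -/
lemma fderiv_frameComponents_eq_zero {X N : M → E3} (hX : IsMinimalConformalImmersion X)
    (hN : IsUnitNormalField X N) (hg : IsSingularMap (gaussMap X N))
    {e : OpenPartialHomeomorph M ℂ} (he : e ∈ atlas ℂ M) :
    DifferentiableOn ℝ (fun z => frameComponents (X (e.symm z)) (N (e.symm z))) e.target ∧
    ∀ z ∈ e.target,
      fderiv ℝ (fun z => frameComponents (X (e.symm z)) (N (e.symm z))) z = 0 ∧
      inner ℝ (X (e.symm z)) (frameComponents (X (e.symm z)) (N (e.symm z))) = 0 := by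
  set U := e.target
  set Y : ℂ → E3 := X ∘ e.symm with hYdef
  set n : ℂ → E3 := fun z => frameComponents (X (e.symm z)) (N (e.symm z)) with hn
  have hU : IsOpen U := e.open_target
  have hY : ContDiffOn ℝ ∞ Y U := contDiffOn_comp_chart hX.smooth he
  have hY0 : ∀ z, Y z ≠ 0 := fun z => hX.ne_zero _
  have hYn : ∀ z, ‖Y z‖ ≠ 0 := fun z => norm_ne_zero_iff.2 (hY0 z)
  have hneq : ∀ z, n z = ‖Y z‖⁻¹ • N (e.symm z) := fun z => frameComponents_eq _
  have hinj : ∀ z ∈ U, Function.Injective (fderiv ℝ Y z) := hX.immersion e he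
  have hunit : ∀ z ∈ U, inner ℝ (n z) (n z) = 1 := by
    intro z _
    have h := hN.unit (e.symm z)
    change inner ℝ _ _ / ‖Y z‖ ^ 2 = 1 at h
    rw [hneq, inner_smul_left, inner_smul_right, ← h, conj_trivial]
    field_simp [hYn z]
  have hNn : ∀ z ∈ U, IsNormalVector Y z (n z) := by
    intro z hz a
    have h := (metric_eq_zero_iff (hY0 z) _ _).1 (hN.normal e he z hz a)
    rw [metric_eq_zero_iff (hY0 z), hneq, inner_smul_left, h, mul_zero]
  have hnor : ∀ z ∈ U, ∀ a, inner ℝ (fderiv ℝ Y z a) (n z) = 0 := by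
    intro z hz a
    have h1 := (metric_eq_zero_iff (hY0 z) _ _).1 (hNn z hz 0)
    have h2 := (metric_eq_zero_iff (hY0 z) _ _).1 (hNn z hz 1)
    have ha : a = a.re • (1 : ℂ) + a.im • Complex.I := by apply Complex.ext <;> simp
    rw [real_inner_comm] at h1 h2
    simp only [tangent, dir, Matrix.cons_val_zero, Matrix.cons_val_one] at h1 h2
    rw [ha, map_add, map_smul, map_smul, inner_add_left, inner_smul_left, inner_smul_left, h1, h2]
    simp
  have horth : ∀ z ∈ U, inner ℝ (fderiv ℝ Y z 1) (fderiv ℝ Y z Complex.I) = 0 := by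
    intro z hz
    exact (metric_eq_zero_iff (hY0 z) _ _).1 (hX.conformal e he z hz).2
  have hconf : ∀ z ∈ U, inner ℝ (fderiv ℝ Y z 1) (fderiv ℝ Y z 1) =
      inner ℝ (fderiv ℝ Y z Complex.I) (fderiv ℝ Y z Complex.I) := by
    intro z hz
    have h := (hX.conformal e he z hz).1
    simp only [firstForm, Matrix.of_apply, metric] at h
    exact (div_left_inj' (pow_ne_zero 2 (hYn z))).1 h
  have hncont : ContinuousOn n U := by
    have hsymm : ContinuousOn e.symm U := e.continuousOn_symm
    have : n = fun z => ‖Y z‖⁻¹ • N (e.symm z) := funext hneq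
    rw [this]
    exact (hY.continuousOn.norm.inv₀ fun z _ => hYn z).smul (hN.continuous.comp_continuousOn hsymm)
  have hns : ContDiffOn ℝ ∞ n U := contDiffOn_normal hU hY hncont hunit hnor hinj horth
  have hmin : ∀ z ∈ U, (inner ℝ (fderiv ℝ Y z 1) (fderiv ℝ n z 1) +
        inner ℝ (fderiv ℝ Y z Complex.I) (fderiv ℝ n z Complex.I)) * inner ℝ (Y z) (Y z) =
      2 * inner ℝ (fderiv ℝ Y z 1) (fderiv ℝ Y z 1) * inner ℝ (Y z) (n z) := by
    intro z hz
    have h := inner_laplacian_of_meanCurvature_eq_zero (hY0 z) (hX.conformal e he z hz)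
      (fun h => one_ne_zero (hinj z hz (by simp [h]))) (hNn z hz)
      (hX.minimal e he z hz _ (hNn z hz))
    -- `⟪Y_aa, n⟫ = -⟪Y_a, n_a⟫`, because `⟪Y_a, n⟫ = 0`
    have w : ∀ a, inner ℝ (fderiv ℝ (fun w => fderiv ℝ Y w a) z a) (n z) =
        -inner ℝ (fderiv ℝ Y z a) (fderiv ℝ n z a) := by
      intro a
      have e0 : (fun w => inner ℝ (fderiv ℝ Y w a) (n w)) =ᶠ[nhds z] fun _ => (0 : ℝ) := by
        filter_upwards [hU.mem_nhds hz] with w hw using hnor w hw a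
      have e1 := DFunLike.congr_fun (e0.fderiv_eq (𝕜 := ℝ)) a
      rw [fderiv_inner_apply ℝ ((contDiffOn_fderiv_apply hU hY a).differentiableAt_of_isOpen hU hz)
        (hns.differentiableAt_of_isOpen hU hz), fderiv_fun_const] at e1
      exact eq_neg_of_add_eq_zero_right e1
    rw [w, w] at h
    linear_combination -h
  have hsing : ∀ z ∈ U, ∃ w ≠ 0, fderiv ℝ n z w = 0 := by
    intro z hz
    exact exists_fderiv_eq_zero_of_stereo (hns.differentiableAt_of_isOpen hU hz)
      (Filter.eventually_of_mem (hU.mem_nhds hz) hunit) (hg e he z hz).1 (hg e he z hz).2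
  refine ⟨hns.differentiableOn (by simp), fun z hz => ?_⟩
  have h0 := fderiv_normal_eq_zero hU hY hns hunit hnor hinj hconf horth hmin hsing hz
  refine ⟨h0, ?_⟩
  have h := hmin z hz
  rw [h0] at h
  have l0 : inner ℝ (fderiv ℝ Y z 1) (fderiv ℝ Y z 1) ≠ 0 :=
    inner_self_ne_zero.2 fun h => one_ne_zero (hinj z hz (by simp [h]))
  simp only [zero_apply, inner_zero_right, add_zero, zero_mul] at h
  exact (mul_eq_zero.1 h.symm).resolve_left (mul_ne_zero two_ne_zero l0)

lemma isLocallyConstant_frameComponents {X N : M → E3} (hX : IsMinimalConformalImmersion X)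
    (hN : IsUnitNormalField X N) (hg : IsSingularMap (gaussMap X N)) :
    IsLocallyConstant fun p => frameComponents (X p) (N p) := by
  rw [IsLocallyConstant.iff_eventually_eq]
  intro p
  obtain ⟨hd, h⟩ := fderiv_frameComponents_eq_zero hX hN hg (chart_mem_atlas ℂ p)
  have ho := (chartAt ℂ p).open_target.isOpen_inter_preimage_of_fderiv_eq_zero hd (fun z hz => (h z hz).1)
    {frameComponents (X p) (N p)}
  have hp : p ∈ (chartAt ℂ p).source := mem_chart_source ℂ p
  have hmem := ho.mem_nhds (x := chartAt ℂ p p) ⟨(chartAt ℂ p).map_source hp, by simp [(chartAt ℂ p).left_inv hp]⟩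
  filter_upwards [((chartAt ℂ p).continuousAt hp).preimage_mem_nhds hmem, (chartAt ℂ p).open_source.mem_nhds hp]
    with q hq hqs
  have := hq.2
  simpa [(chartAt ℂ p).left_inv hqs] using this

end Surface

end S2R

/-- A connected Riemann surface minimally and conformally immersed into `S² × ℝ` with singular
Gauss map is part of a vertical cylinder over a geodesic of `S²`, and its Gauss map is constant. -/
theorem mainTheorem3 {M : Type*} [TopologicalSpace M] [ConnectedSpace M] [ChartedSpace ℂ M]
    [IsManifold 𝓘(ℂ, ℂ) 1 M] (X N : M → S2R.E3)
    (hX : S2R.IsMinimalConformalImmersion X) (hN : S2R.IsUnitNormalField X N)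
    (hg : S2R.IsSingularMap (S2R.gaussMap X N)) :
    (∃ γ : ℝ → S2R.S2, S2R.IsSphereGeodesic γ ∧
        Set.range X ⊆ S2R.toModel '' S2R.verticalCylinder γ) ∧
      ∃ c : OnePoint ℂ, ∀ p, S2R.gaussMap X N p = c := by
  have hconst := S2R.isLocallyConstant_frameComponents hX hN hg
  obtain ⟨p₀⟩ : Nonempty M := inferInstance
  set c := S2R.frameComponents (X p₀) (N p₀) with hc
  have hall : ∀ p, S2R.frameComponents (X p) (N p) = c := fun p =>
    hconst.apply_eq_of_preconnectedSpace p p₀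
  have hcc : inner ℝ c c = (1 : ℝ) := by
    have h := hN.unit p₀
    have h0 : ‖X p₀‖ ≠ 0 := norm_ne_zero_iff.2 (hX.ne_zero p₀)
    rw [S2R.metric] at h
    rw [hc, S2R.frameComponents_eq, inner_smul_left, inner_smul_right, ← h, conj_trivial]
    field_simp
  refine ⟨?_, S2R.stereo c, fun p => by rw [S2R.gaussMap, hall]⟩
  obtain ⟨γ, hγ, hγX⟩ := S2R.exists_geodesic_of_inner_eq_zero hcc
  refine ⟨γ, hγ, ?_⟩
  rintro _ ⟨p, rfl⟩
  refine hγX _ (hX.ne_zero p) ?_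
  have h := ((S2R.fderiv_frameComponents_eq_zero hX hN hg (chart_mem_atlas ℂ p)).2 _
    (mem_chart_target ℂ p)).2
  rwa [(chartAt ℂ p).left_inv (mem_chart_source ℂ p), hall] at h
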